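/- **Setting.** Let $\xi^1\ge\xi^2\ge\dots\ge\xi^N$ be real samples, $\mathbb P_0=\frac1N\sum_n\delta_{\xi^n}$, $\epsilon>0$, and let $$\mathcal D=\{f:\ f\text{ a probability law on the set }\{\xi^1,\dots,\xi^N\},\ W(f,\mathbb P_0)\le\epsilon\},$$ where $W(f,\mathbb P_0)=\inf_{\mathbb Q}\mathbb E_{\mathbb Q}|\xi_1-\xi_2|$ is the Wasserstein distance, the infimum being over joint laws $\mathbb Q$ of $(\xi_1,\xi_2)$ with marginals $f$ and $\mathbb P_0$ (finite support, unknown atom masses). Let $\mathcal X\subseteq\mathbb R^d$, let $c\in\mathbb R^d$, let $T$ be a $1\times d$ row, and let $0<\bar\alpha<1$. The risk-adjustable DRCC problem is $$z_0=\inf\Big\{c^\top x+g(\alpha):\ x\in\mathcal X,\ \alpha\in[0,\bar\alpha],\ \inf_{f\in\mathcal D}\mathbb P_f(Tx\ge\xi)\ge 1-\alpha\Big\}.$$ For a tolerance $\alpha$ let $t_\alpha=\inf\{v:\inf_{f\in\mathcal D}\mathbb P_f(v\ge\xi)\ge1-\alpha\}$ be the worst-case VaR. Let $1\le N'\le N$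 be such that for every $n\le N'$ there is a smallest $\alpha_n\in[0,1)$ with $t_{\alpha_n}=\xi^n$, while for $n>N'$ no $\alpha\in[0,\bar\alpha]$ has $t_\alpha=\xi^n$. Let $g$ be real-valued and nondecreasing on $[0,\bar\alpha]\cup\{\alpha_1,\dots,\alpha_{N'}\}$, let $M_n\ge\xi^n-\xi^{N'}$ for $n<N'$, and put $\Delta_n=g(\alpha_n)-g(\alpha_{n+1})$ for $n<N'$ and $\Delta_{N'}=g(\alpha_{N'})$. **Theorem.** One has $\Delta_n\le0$ for $n<N'$, and the risk-adjustable DRCC problem is equivalent to the MILP $$\begin{aligned} z^d=\inf_{x\in\mathcal X,\,y}\ & c^\top x+\sum_{n=1}^{N'-1}\Delta_ny_n+\Delta_{N'}\\ \text{s.t. } & Tx\ge\xi^n-M_n(1-y_n),\quad n=1,\dots,N'-1,\\ & Tx\ge\xi^{N'},\\ & \sum_{n=1}^{N'-1}(\alpha_n-\alpha_{n+1})y_n+\alpha_{N'}\in[0,\bar\alpha],\\ & y_n\in\{0,1\},\quad n=1,\dots,N'-1,\end{aligned}$$ in the following sense: $z_0=z^d$ (in $[-\infty,+\infty]$), and for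 every $x$, $x$ is part of an optimal solution $(x,\alpha)$ of the DRCC problem if and only if it is part of an optimal solution $(x,y)$ of the MILP. If $g$ is right-continuous at $0$, the optimal value of the DRCC problem with $0<\alpha\le\bar\alpha$ in place of $\alpha\in[0,\bar\alpha]$ is also $z^d$. If $M_n=\xi^n-\xi^{N'}$ for at least one $n<N'$, the constraint $Tx\ge\xi^{N'}$ is implied by the others and may be omitted. -/

import Mathlib

open MeasureTheory
open scoped ENNReal

noncomputable section

/-- The (type-1) Wasserstein distance of two laws on `ℝ`: the infimum of the expected distance
`|ξ₁ - ξ₂|` over all joint laws with the given marginals (all `p`-norms on `ℝ` are `|·|`). -/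
def wassersteinDist (μ ν : Measure ℝ) : ℝ≥0∞ :=
  ⨅ (π : Measure (ℝ × ℝ)) (_ : π.map Prod.fst = μ ∧ π.map Prod.snd = ν),
    ∫⁻ z, edist z.1 z.2 ∂π

/-- The empirical distribution of the samples: mass `1/N` at each sample (with multiplicity). -/
def empiricalLaw {N : ℕ} (ξ : Fin N → ℝ) : Measure ℝ :=
  (N : ℝ≥0∞)⁻¹ • ∑ n, Measure.dirac (ξ n)

/-- The Wasserstein ambiguity set under the finite distribution assumption: all probability laws
on the finite set of atoms `{ξ n}`, with unknown masses, within distance `ε` of the empirical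
distribution. -/
def ambiguitySet {N : ℕ} (ξ : Fin N → ℝ) (ε : ℝ) : Set (Measure ℝ) :=
  {f | IsProbabilityMeasure f ∧ f (Set.range ξ)ᶜ = 0 ∧
    wassersteinDist f (empiricalLaw ξ) ≤ ENNReal.ofReal ε}

/-- The distributionally robust chance constraint
`inf_{f ∈ 𝒟} ℙ_f (v ≥ ξ) ≥ 1 - α` at the level `v` (which is `T x` in the problem). -/
def DRCC {N : ℕ} (ξ : Fin N → ℝ) (ε v α : ℝ) : Prop :=
  ENNReal.ofReal (1 - α) ≤ ⨅ f ∈ ambiguitySet ξ ε, f {s : ℝ | s ≤ v}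

/-- The worst-case value-at-risk at the risk tolerance `α`. -/
def worstCaseVaR {N : ℕ} (ξ : Fin N → ℝ) (ε α : ℝ) : ℝ :=
  sInf {v : ℝ | DRCC ξ ε v α}

/-- The optimal value (infimum, `+∞` if infeasible) of minimising `obj` over `S`. -/
def optimalValue {β : Type} (obj : β → ℝ) (S : Set β) : EReal :=
  ⨅ p ∈ S, (obj p : EReal)

/-- `p` is an optimal solution of minimising `obj` over `S`. -/
def IsOptimalSolution {β : Type} (obj : β → ℝ) (S : Set β) (p : β) : Prop :=
  p ∈ S ∧ ∀ q ∈ S, obj p ≤ obj q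

/-- The feasible pairs `(x, α)` of the risk-adjustable DRCC problem, with the risk tolerance `α`
ranging over `A`. -/
def drccFeasible {d N : ℕ} (X : Set (Fin d → ℝ)) (T : Fin d → ℝ) (ξ : Fin N → ℝ) (ε : ℝ)
    (A : Set ℝ) : Set ((Fin d → ℝ) × ℝ) :=
  {p | p.1 ∈ X ∧ DRCC ξ ε (T ⬝ᵥ p.1) p.2 ∧ p.2 ∈ A}

/-- The objective `cᵀ x + g(α)` of the risk-adjustable DRCC problem. -/
def drccObjective {d : ℕ} (c : Fin d → ℝ) (g : ℝ → ℝ) (p : (Fin d → ℝ) × ℝ) : ℝ :=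
  c ⬝ᵥ p.1 + g p.2

/-- The feasible pairs `(x, y)` of the constraints
`T x ≥ ξₙ - Mₙ (1 - yₙ)`, `∑ (αₙ - αₙ₊₁) yₙ + α_{k+1} ∈ [0, ᾱ]`, `yₙ ∈ {0,1}` (`n = 1, …, k`).
Here `N' = k + 1`, and `ξ`, `α` are the first `N'` samples and their tolerances. -/
def bigMFeasible {d k : ℕ} (X : Set (Fin d → ℝ)) (T : Fin d → ℝ) (ξ : Fin (k + 1) → ℝ)
    (M : Fin k → ℝ) (α : Fin (k + 1) → ℝ) (αbar : ℝ) : Set ((Fin d → ℝ) × (Fin k → ℝ)) :=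
  {p | p.1 ∈ X ∧
    (∀ n : Fin k, T ⬝ᵥ p.1 ≥ ξ n.castSucc - M n * (1 - p.2 n)) ∧
    (∑ n : Fin k, (α n.castSucc - α n.succ) * p.2 n + α (Fin.last k)) ∈ Set.Icc 0 αbar ∧
    ∀ n : Fin k, p.2 n = 0 ∨ p.2 n = 1}

/-- The feasible pairs `(x, y)` of the MILP: the constraints above together with
`T x ≥ ξ_{N'}` (the big-M constraint of the last index, whose binary is fixed to `1`). -/
def milpFeasible {d k : ℕ} (X : Set (Fin d → ℝ)) (T : Fin d → ℝ) (ξ : Fin (k + 1) → ℝ)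
    (M : Fin k → ℝ) (α : Fin (k + 1) → ℝ) (αbar : ℝ) : Set ((Fin d → ℝ) × (Fin k → ℝ)) :=
  {p | p ∈ bigMFeasible X T ξ M α αbar ∧ T ⬝ᵥ p.1 ≥ ξ (Fin.last k)}

/-- The coefficients `Δₙ = g(αₙ) - g(αₙ₊₁)`, `n = 1, …, N' - 1`. -/
def riskDelta {k : ℕ} (g : ℝ → ℝ) (α : Fin (k + 1) → ℝ) (n : Fin k) : ℝ :=
  g (α n.castSucc) - g (α n.succ)

/-- The objective `cᵀ x + ∑ Δₙ yₙ + Δ_{N'}` of the MILP, where `Δ_{N'} = g(α_{N'})`. -/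
def milpObjective {d k : ℕ} (c : Fin d → ℝ) (g : ℝ → ℝ) (α : Fin (k + 1) → ℝ)
    (p : (Fin d → ℝ) × (Fin k → ℝ)) : ℝ :=
  c ⬝ᵥ p.1 + ∑ n : Fin k, riskDelta g α n * p.2 n + g (α (Fin.last k))

end

/-! Laws in the ambiguity set live on the samples, so for each tolerance in `[0, 1)` the admissible
levels form a ray starting at a sample (`exists_setOf_DRCC_eq_Ici`). A tolerance `a` with VaR `ξ m`
can thus be lowered to `α m` at no extra cost, leaving finitely many choices of `m`. Encoding `m` by
`y n = 1` exactly for `n ≥ m` makes both sums telescope to `α m` and `g (α m)`. Any other binary `y`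
is dominated by the encoding of its first active index, as all increments are nonpositive. Hence the
two problems dominate each other with `x` fixed. -/

theorem empiricalLaw_mem_ambiguitySet {N : ℕ} (hN : 0 < N) (ξ : Fin N → ℝ) (ε : ℝ) :
    empiricalLaw ξ ∈ ambiguitySet ξ ε := by
  have hN0 : (N : ℝ≥0∞) ≠ 0 := by exact_mod_cast hN.ne'
  refine ⟨⟨?_⟩, ?_, ?_⟩
  · simp [empiricalLaw, ENNReal.inv_mul_cancel hN0 (ENNReal.natCast_ne_top N)]
  · have hr : MeasurableSet (Set.range ξ)ᶜ := (Set.finite_range ξ).measurableSet.compl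
    simp [empiricalLaw, Measure.dirac_apply' _ hr]
  -- The diagonal coupling has zero cost.
  · have hd : Measurable fun s : ℝ => (s, s) := measurable_id.prodMk measurable_id
    refine (iInf₂_le ((empiricalLaw ξ).map fun s => (s, s)) ⟨?_, ?_⟩).trans ?_
    · rw [lintegral_map (measurable_fst.edist measurable_snd) hd]
      simp
    · rw [Measure.map_map measurable_fst hd]
      exact Measure.map_id
    · rw [Measure.map_map measurable_snd hd]
      exact Measure.map_id

section ChanceConstraint

variable {N : ℕ} {ξ : Fin N → ℝ} {ε : ℝ}

theorem DRCC.mono {v w a b : ℝ} (h : DRCC ξ ε v a) (hvw : v ≤ w) (hab : a ≤ b) :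
    DRCC ξ ε w b := by
  refine (ENNReal.ofReal_le_ofReal (by linarith)).trans (h.trans ?_)
  exact iInf₂_mono fun f _ => measure_mono fun s (hs : s ≤ v) => hs.trans hvw

/-- Only the position of `v` relative to the samples matters. -/
theorem DRCC.of_forall_le {v w a : ℝ} (h : DRCC ξ ε v a) (hvw : ∀ n, ξ n ≤ v → ξ n ≤ w) :
    DRCC ξ ε w a := by
  refine h.trans (iInf₂_mono fun f hf => ?_)
  refine measure_mono_ae ?_
  have hsupp : ∀ᵐ s ∂f, s ∈ Set.range ξ := hf.2.1
  filter_upwards [hsupp] with s hs hsv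
  obtain ⟨n, rfl⟩ := hs
  exact hvw n hsv

/-- The empirical law puts no mass below all samples. Its membership is essential: an infimum over
an empty ambiguity set would be `⊤`. -/
theorem DRCC.exists_le (hN : 0 < N) {v a : ℝ} (ha : a < 1) (h : DRCC ξ ε v a) :
    ∃ n, ξ n ≤ v := by
  by_contra! hv
  have hmem := empiricalLaw_mem_ambiguitySet hN ξ ε
  have hle := h.trans (iInf₂_le _ hmem)
  have hzero : empiricalLaw ξ {s | s ≤ v} = 0 :=
    measure_mono_null (t := (Set.range ξ)ᶜ)
      (fun s (hs : s ≤ v) ⟨n, hn⟩ => (hv n).not_ge (hn.trans_le hs)) hmem.2.1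
  rw [hzero, nonpos_iff_eq_zero, ENNReal.ofReal_eq_zero] at hle
  linarith

theorem DRCC.of_forall_sample_le {v a : ℝ} (ha : 0 ≤ a) (hv : ∀ n, ξ n ≤ v) :
    DRCC ξ ε v a := by
  refine le_iInf₂ fun f hf => ?_
  have := hf.1
  have hsupp : ∀ᵐ s ∂f, s ∈ {s : ℝ | s ≤ v} := by
    have hrange : ∀ᵐ s ∂f, s ∈ Set.range ξ := hf.2.1
    filter_upwards [hrange] with s hs
    obtain ⟨n, rfl⟩ := hs
    exact hv n
  have hone : f {s : ℝ | s ≤ v} = 1 :=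
    (measure_congr (Filter.eventuallyEq_univ.2 hsupp)).trans measure_univ
  rw [hone]
  exact ENNReal.ofReal_le_one.2 (by linarith)

/-- The levels satisfying the chance constraint form a closed ray starting at a sample. -/
theorem exists_setOf_DRCC_eq_Ici (hN : 0 < N) {a : ℝ} (ha : a ∈ Set.Ico (0 : ℝ) 1) :
    ∃ m, {v | DRCC ξ ε v a} = Set.Ici (ξ m) := by
  have : Nonempty (Fin N) := ⟨⟨0, hN⟩⟩
  obtain ⟨top, htop⟩ := Finite.exists_max ξ
  obtain ⟨m, hm, hmin⟩ := Set.exists_min_image {n | DRCC ξ ε (ξ n) a} ξ (Set.toFinite _)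
    ⟨top, DRCC.of_forall_sample_le ha.1 htop⟩
  refine ⟨m, Set.Subset.antisymm (fun v hv => ?_) fun v hv => DRCC.mono hm hv le_rfl⟩
  -- Lowering `v` to the largest sample below it preserves the chance constraint.
  obtain ⟨n, hn, hmax⟩ := Set.exists_max_image {n | ξ n ≤ v} ξ (Set.toFinite _)
    (DRCC.exists_le hN ha.2 hv)
  exact (hmin n (DRCC.of_forall_le hv hmax)).trans hn

theorem exists_worstCaseVaR_eq (hN : 0 < N) {a : ℝ} (ha : a ∈ Set.Ico (0 : ℝ) 1) :
    ∃ m, worstCaseVaR ξ ε a = ξ m := by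
  obtain ⟨m, hm⟩ := exists_setOf_DRCC_eq_Ici (ξ := ξ) (ε := ε) hN ha
  exact ⟨m, by rw [worstCaseVaR, hm, csInf_Ici]⟩

theorem DRCC_iff_worstCaseVaR_le (hN : 0 < N) {v a : ℝ} (ha : a ∈ Set.Ico (0 : ℝ) 1) :
    DRCC ξ ε v a ↔ worstCaseVaR ξ ε a ≤ v := by
  obtain ⟨m, hm⟩ := exists_setOf_DRCC_eq_Ici (ξ := ξ) (ε := ε) hN ha
  rw [worstCaseVaR, hm, csInf_Ici]
  exact Set.ext_iff.1 hm v

theorem worstCaseVaR_antitoneOn (hN : 0 < N) :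
    AntitoneOn (worstCaseVaR ξ ε) (Set.Ico 0 1) := fun _ ha _ hb hab =>
  (DRCC_iff_worstCaseVaR_le hN hb).1 (((DRCC_iff_worstCaseVaR_le hN ha).2 le_rfl).mono le_rfl hab)

/-- Smallest tolerances of smaller values-at-risk are larger. -/
theorem le_of_isLeast_worstCaseVaR (hN : 0 < N) {s t a b : ℝ}
    (ha : IsLeast {a : ℝ | a ∈ Set.Ico 0 1 ∧ worstCaseVaR ξ ε a = s} a)
    (hb : IsLeast {a : ℝ | a ∈ Set.Ico 0 1 ∧ worstCaseVaR ξ ε a = t} b) (hts : t ≤ s) :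
    a ≤ b := by
  by_contra! hba
  have hst : s ≤ t := by
    have := worstCaseVaR_antitoneOn (ξ := ξ) (ε := ε) hN hb.1.1 ha.1.1 hba.le
    rwa [ha.1.2, hb.1.2] at this
  -- Now `s = t`, so `b < a` contradicts the leastness of `a`; this also covers repeated samples.
  exact hba.not_ge (ha.2 ⟨hb.1.1, hb.1.2.trans (le_antisymm hts hst)⟩)

end ChanceConstraint

section OptimalValue

variable {β γ : Type} {f : β → ℝ} {h : γ → ℝ} {S : Set β} {R : Set γ}

theorem optimalValue_le_of_forall_exists (hSR : ∀ q ∈ R, ∃ p ∈ S, f p ≤ h q) :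
    optimalValue f S ≤ optimalValue h R :=
  le_iInf₂ fun q hq =>
    let ⟨p, hp, hpq⟩ := hSR q hq
    (iInf₂_le p hp).trans (EReal.coe_le_coe_iff.2 hpq)

/-- Symmetric in the two problems, so it yields both directions of the equivalence of optimal `x`.
-/
theorem exists_isOptimalSolution_of_forall_exists {δ : Type} {f : δ × β → ℝ} {h : δ × γ → ℝ}
    {S : Set (δ × β)} {R : Set (δ × γ)}
    (hSR : ∀ x b, (x, b) ∈ S → ∃ y, (x, y) ∈ R ∧ h (x, y) ≤ f (x, b))
    (hRS : ∀ x y, (x, y) ∈ R → ∃ b, (x, b) ∈ S ∧ f (x, b) ≤ h (x, y)) {x : δ}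
    (hx : ∃ b, IsOptimalSolution f S (x, b)) : ∃ y, IsOptimalSolution h R (x, y) := by
  obtain ⟨b, hb, hopt⟩ := hx
  obtain ⟨y, hy, hyb⟩ := hSR x b hb
  refine ⟨y, hy, fun q hq => ?_⟩
  obtain ⟨b', hb', hle⟩ := hRS q.1 q.2 hq
  exact hyb.trans ((hopt _ hb').trans hle)

end OptimalValue

section Telescoping

variable {k : ℕ}

/-- Switching on all increments from the index `m` on telescopes to the value at `m`. -/
theorem sum_sub_mul_indicator_add_last (u : Fin (k + 1) → ℝ) (m : Fin (k + 1)) :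
    ∑ n : Fin k, (u n.castSucc - u n.succ) * (if m ≤ n.castSucc then 1 else 0) + u (Fin.last k)
      = u m := by
  induction k with
  | zero => simp [Fin.fin_one_eq_zero m]
  | succ k ih =>
    rw [Fin.sum_univ_castSucc]
    rcases Fin.eq_castSucc_or_eq_last m with ⟨m, rfl⟩ | rfl
    · have := ih (fun n => u n.castSucc) m
      simp only [Fin.castSucc_le_castSucc_iff, Fin.le_last, if_true, Fin.succ_castSucc,
        Fin.succ_last] at this ⊢
      linarith
    · simp

/-- A binary choice of increments of a monotone sequence, the first of which is at `m`, gives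
at least the value at `m`. -/
theorem exists_le_sum_sub_mul_add_last (y : Fin k → ℝ) (hy : ∀ n, y n = 0 ∨ y n = 1) :
    ∃ m : Fin (k + 1), (m = Fin.last k ∨ ∃ n : Fin k, m = n.castSucc ∧ y n = 1) ∧
      ∀ u : Fin (k + 1) → ℝ, Monotone u →
        u m ≤ ∑ n : Fin k, (u n.castSucc - u n.succ) * y n + u (Fin.last k) := by
  -- The last index counts as active. The choice of `m` precedes `u`, so one `m` serves both `α` and
  -- `g ∘ α`.
  obtain ⟨m, hm, hmin⟩ := Set.exists_min_image
    {m : Fin (k + 1) | m = Fin.last k ∨ ∃ n : Fin k, m = n.castSucc ∧ y n = 1} id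
    (Set.toFinite _) ⟨Fin.last k, Or.inl rfl⟩
  refine ⟨m, hm, fun u hu => ?_⟩
  rw [← sum_sub_mul_indicator_add_last u m]
  refine add_le_add_left (Finset.sum_le_sum fun n _ => ?_) _
  refine mul_le_mul_of_nonpos_left ?_ (sub_nonpos.2 (hu n.castSucc_le_succ))
  rcases hy n with h | h
  · rw [h]; split_ifs <;> norm_num
  · have hmn : m ≤ n.castSucc := hmin _ (Or.inr ⟨n, rfl, h⟩)
    rw [h, if_pos hmn]

end Telescoping

section Feasibility

variable {d k : ℕ} {X : Set (Fin d → ℝ)} {T : Fin d → ℝ}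

theorem bigMFeasible_eq_milpFeasible {ξ : Fin (k + 1) → ℝ} (hξ : Antitone ξ) {M : Fin k → ℝ}
    (α : Fin (k + 1) → ℝ) (αbar : ℝ) (hM : ∃ n, M n = ξ n.castSucc - ξ (Fin.last k)) :
    bigMFeasible X T ξ M α αbar = milpFeasible X T ξ M α αbar := by
  refine Set.Subset.antisymm (fun p hp => ⟨hp, ?_⟩) fun p hp => hp.1
  obtain ⟨n, hn⟩ := hM
  have hT := hp.2.1 n
  have hle := hξ (Fin.le_last n.castSucc)
  -- With `M n` tight, `y n = 0` gives exactly the omitted constraint, and `y n = 1` a stronger one.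
  rcases hp.2.2.2 n with h | h <;> rw [h, hn] at hT <;> linarith

theorem mem_milpFeasible_indicator {ξ : Fin (k + 1) → ℝ} (hξ : Antitone ξ) {M : Fin k → ℝ}
    (hM : ∀ n : Fin k, ξ n.castSucc - ξ (Fin.last k) ≤ M n) {α : Fin (k + 1) → ℝ} {αbar : ℝ}
    {x : Fin d → ℝ} (hx : x ∈ X) {m : Fin (k + 1)} (hT : ξ m ≤ T ⬝ᵥ x)
    (hm : α m ∈ Set.Icc 0 αbar) :
    (x, fun n : Fin k => if m ≤ n.castSucc then (1 : ℝ) else 0) ∈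
      milpFeasible X T ξ M α αbar := by
  have hlast : ξ (Fin.last k) ≤ T ⬝ᵥ x := (hξ (Fin.le_last m)).trans hT
  refine ⟨⟨hx, fun n => ?_, ?_, fun n => ?_⟩, hlast⟩
  · dsimp only
    split_ifs with h
    · linarith [hξ h]
    · linarith [hM n]
  · rwa [sum_sub_mul_indicator_add_last]
  · dsimp only
    split_ifs <;> simp

theorem optimalValue_drcc_Ioc_eq_Icc {N : ℕ} (ξ : Fin N → ℝ) (ε : ℝ) (c : Fin d → ℝ)
    {g : ℝ → ℝ} {αbar : ℝ} (hαbar : 0 < αbar) (hg : ContinuousWithinAt g (Set.Ioi 0) 0) :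
    optimalValue (drccObjective c g) (drccFeasible X T ξ ε (Set.Ioc 0 αbar)) =
      optimalValue (drccObjective c g) (drccFeasible X T ξ ε (Set.Icc 0 αbar)) := by
  refine le_antisymm (le_iInf₂ fun p hp => ?_)
    (optimalValue_le_of_forall_exists fun q hq =>
      ⟨q, ⟨hq.1, hq.2.1, Set.Ioc_subset_Icc_self hq.2.2⟩, le_rfl⟩)
  obtain ⟨x, a⟩ := p
  obtain ⟨hx, hdr, ha⟩ := hp
  -- A point feasible at tolerance `0` stays feasible at every small `b > 0`, and its cost is the
  -- limit as `b` tends to `0`.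
  rcases ha.1.eq_or_lt with h0 | h0
  · obtain rfl : 0 = a := h0
    have hlim : Filter.Tendsto (fun b => ((drccObjective c g (x, b) : ℝ) : EReal))
        (nhdsWithin 0 (Set.Ioi 0)) (nhds (drccObjective c g (x, 0) : ℝ)) :=
      (continuous_coe_real_ereal.tendsto _).comp (hg.const_add _)
    refine ge_of_tendsto hlim ?_
    filter_upwards [Ioc_mem_nhdsGT hαbar] with b hb
    exact iInf₂_le (x, b) ⟨hx, hdr.mono le_rfl hb.1.le, hb⟩
  · exact iInf₂_le (x, a) ⟨hx, hdr, h0, ha.2⟩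

end Feasibility

theorem theorem1 {d N k : ℕ} (hk : k + 1 ≤ N)
    (X : Set (Fin d → ℝ)) (c T : Fin d → ℝ)
    (ξ : Fin N → ℝ) (hξ : Antitone ξ)
    (ε : ℝ) (hε : 0 < ε)
    (αbar : ℝ) (hαbar : 0 < αbar) (hαbar_lt : αbar < 1)
    (α : Fin (k + 1) → ℝ)
    -- `α n` is the smallest risk tolerance whose worst-case VaR is the `n`-th sample, `n ≤ N'`
    (hα : ∀ n : Fin (k + 1),
      IsLeast {a : ℝ | a ∈ Set.Ico 0 1 ∧ worstCaseVaR ξ ε a = ξ (Fin.castLE hk n)} (α n))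
    -- the samples after the first `N' = k + 1` have no admissible risk tolerance
    (hlast : ∀ n : Fin N, k < n.val → ¬ ∃ a ∈ Set.Icc 0 αbar, worstCaseVaR ξ ε a = ξ n)
    (g : ℝ → ℝ) (hg : MonotoneOn g (Set.Icc 0 αbar ∪ Set.range α))
    (M : Fin k → ℝ)
    (hM : ∀ n : Fin k, ξ (Fin.castLE hk n.castSucc) - ξ (Fin.castLE hk (Fin.last k)) ≤ M n) :
    -- the risk-cost coefficients are non-positive
    (∀ n : Fin k, riskDelta g α n ≤ 0) ∧
    -- the two problems have the same optimal value
    optimalValue (drccObjective c g) (drccFeasible X T ξ ε (Set.Icc 0 αbar)) =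
      optimalValue (milpObjective c g α)
        (milpFeasible X T (fun n => ξ (Fin.castLE hk n)) M α αbar) ∧
    -- and the same optimal decisions `x`
    (∀ x : Fin d → ℝ,
      (∃ a : ℝ, IsOptimalSolution (drccObjective c g)
        (drccFeasible X T ξ ε (Set.Icc 0 αbar)) (x, a)) ↔
      (∃ y : Fin k → ℝ, IsOptimalSolution (milpObjective c g α)
        (milpFeasible X T (fun n => ξ (Fin.castLE hk n)) M α αbar) (x, y))) ∧
    -- the value is the same with `0 < α ≤ ᾱ` in the DRCC problem if `g` is right-continuous at `0`
    (ContinuousWithinAt g (Set.Ioi 0) 0 →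
      optimalValue (drccObjective c g) (drccFeasible X T ξ ε (Set.Ioc 0 αbar)) =
        optimalValue (milpObjective c g α)
          (milpFeasible X T (fun n => ξ (Fin.castLE hk n)) M α αbar)) ∧
    -- if some big-M constant is tight, the constraint `T x ≥ ξ_{N'}` may be left out
    ((∃ n : Fin k, M n = ξ (Fin.castLE hk n.castSucc) - ξ (Fin.castLE hk (Fin.last k))) →
      bigMFeasible X T (fun n => ξ (Fin.castLE hk n)) M α αbar =
        milpFeasible X T (fun n => ξ (Fin.castLE hk n)) M α αbar) := by
  have hN : 0 < N := by omega
  set ζ : Fin (k + 1) → ℝ := fun n => ξ (Fin.castLE hk n) with hζ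
  have hζanti : Antitone ζ := fun i j hij => hξ hij
  have hαmono : Monotone α := fun i j hij =>
    le_of_isLeast_worstCaseVaR hN (hα i) (hα j) (hζanti hij)
  -- Some `α n` may exceed `αbar`, which is why `g` is monotone on the union.
  have hgα : Monotone (g ∘ α) := fun i j hij =>
    hg (Or.inr ⟨i, rfl⟩) (Or.inr ⟨j, rfl⟩) (hαmono hij)
  have hto : ∀ x a, (x, a) ∈ drccFeasible X T ξ ε (Set.Icc 0 αbar) →
      ∃ y, (x, y) ∈ milpFeasible X T ζ M α αbar ∧
        milpObjective c g α (x, y) ≤ drccObjective c g (x, a) := by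
    rintro x a ⟨hx, hdr, ha⟩
    have ha1 : a ∈ Set.Ico (0 : ℝ) 1 := ⟨ha.1, ha.2.trans_lt hαbar_lt⟩
    obtain ⟨n, hn⟩ := exists_worstCaseVaR_eq (ξ := ξ) (ε := ε) hN ha1
    have hnk : n.val < k + 1 := by
      by_contra! h
      exact hlast n h ⟨a, ha, hn⟩
    set m : Fin (k + 1) := ⟨n, hnk⟩
    have hαa : α m ≤ a := (hα m).2 ⟨ha1, hn⟩
    have hT : ζ m ≤ T ⬝ᵥ x := hn.ge.trans ((DRCC_iff_worstCaseVaR_le hN ha1).1 hdr)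
    refine ⟨_, mem_milpFeasible_indicator hζanti hM hx hT
      ⟨(hα m).1.1.1, hαa.trans ha.2⟩, ?_⟩
    have hsum := sum_sub_mul_indicator_add_last (g ∘ α) m
    have hle := hg (Or.inr ⟨m, rfl⟩) (Or.inl ha) hαa
    simp only [Function.comp_apply] at hsum
    simp only [milpObjective, riskDelta, drccObjective]
    linarith
  have hfrom : ∀ x y, (x, y) ∈ milpFeasible X T ζ M α αbar →
      ∃ a, (x, a) ∈ drccFeasible X T ξ ε (Set.Icc 0 αbar) ∧
        drccObjective c g (x, a) ≤ milpObjective c g α (x, y) := by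
    rintro x y ⟨⟨hx, hbig, hsum, hy⟩, hT⟩
    obtain ⟨m, hm, hle⟩ := exists_le_sum_sub_mul_add_last y hy
    have hTm : ζ m ≤ T ⬝ᵥ x := by
      rcases hm with rfl | ⟨n, rfl, hn⟩
      · exact hT
      · have := hbig n
        simp only [hn] at this
        linarith
    refine ⟨α m, ⟨hx, (DRCC_iff_worstCaseVaR_le hN (hα m).1.1).2 ((hα m).1.2.trans_le hTm),
      (hα m).1.1.1, (hle α hαmono).trans hsum.2⟩, ?_⟩
    have := hle (g ∘ α) hgα
    simp only [Function.comp_apply] at this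
    simp only [milpObjective, riskDelta, drccObjective]
    linarith
  have hval : optimalValue (drccObjective c g) (drccFeasible X T ξ ε (Set.Icc 0 αbar)) =
      optimalValue (milpObjective c g α) (milpFeasible X T ζ M α αbar) :=
    le_antisymm
      (optimalValue_le_of_forall_exists fun q hq =>
        let ⟨a, ha, hle⟩ := hfrom q.1 q.2 hq
        ⟨(q.1, a), ha, hle⟩)
      (optimalValue_le_of_forall_exists fun q hq =>
        let ⟨y, hy, hle⟩ := hto q.1 q.2 hq
        ⟨(q.1, y), hy, hle⟩)
  exact ⟨fun n => sub_nonpos.2 (hgα n.castSucc_le_succ), hval,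
    fun x => ⟨exists_isOptimalSolution_of_forall_exists hto hfrom,
      exists_isOptimalSolution_of_forall_exists hfrom hto⟩,
    fun hcont => (optimalValue_drcc_Ioc_eq_Icc ξ ε c hαbar hcont).trans hval,
    bigMFeasible_eq_milpFeasible hζanti α αbar⟩
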